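/- For a finite group $K$ and $n \ge 0$, let $\alpha_{K,n}$ be the number of orbits of $K$ on $K^n$ under simultaneous conjugation $g\cdot(x_1,\dots,x_n) = (gx_1g^{-1},\dots,gx_ng^{-1})$, and let $A_K(t)=\sum_{n=0}^\infty \alpha_{K,n}t^n \in \mathbb{Q}[[t]]$. **Theorem.** Let $G$ be a finite Frobenius group with Frobenius kernel $N$ and Frobenius complement $H$; that is, $H$ is a proper non-trivial subgroup of $G$ with $H\cap gHg^{-1}=\{1\}$ for all $g\in G\setminus H$, and $N$ is the subgroup of $G$ whose underlying set is $$N=\Big(G\setminus\bigcup_{g\in G} gHg^{-1}\Big)\cup\{1\}.$$ Then, in $\mathbb{Q}[[t]]$, $$|G|\,A_G(t)=\frac{1}{1-|G|t}+\Big(|N|\,A_N(t)-\frac{1}{1-|N|t}\Big)+|N|\Big(|H|\,A_H(t)-\frac{1}{1-|H|t}\Big).$$ -/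

import Mathlib

open scoped PowerSeries Pointwise

/-- The number `α_{G,n}` of simultaneous conjugacy classes of `n`-tuples in `G`: the number of orbits
of `G` acting on `G^n` by `g • (x₁, …, xₙ) = (g x₁ g⁻¹, …, g xₙ g⁻¹)`. -/
noncomputable def simConjClassNumber (G : Type*) [Group G] (n : ℕ) : ℕ :=
  Nat.card (MulAction.orbitRel.Quotient (ConjAct G) (Fin n → G))

/-- The generating function `A_G(t) = ∑ α_{G,n} tⁿ`, as a formal power series over `ℚ`. -/
noncomputable def simConjSeries (G : Type*) [Group G] : ℚ⟦X⟧ :=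
  PowerSeries.mk fun n => (simConjClassNumber G n : ℚ)

/-- `H` is a Frobenius complement of `G`: a proper non-trivial subgroup with `H ∩ gHg⁻¹ = {1}` for
all `g ∈ G \ H`. -/
structure IsFrobeniusComplement {G : Type*} [Group G] (H : Subgroup G) : Prop where
  ne_bot : H ≠ ⊥
  ne_top : H ≠ ⊤
  inf_conj : ∀ g : G, g ∉ H → H ⊓ (MulAut.conj g • H) = ⊥

/-- The Frobenius kernel of `G` with respect to `H`, as a set:
`(G \ ⋃_{g ∈ G} gHg⁻¹) ∪ {1}`. -/
def frobeniusKernel {G : Type*} [Group G] (H : Subgroup G) : Set G :=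
  (⋃ g : G, ((MulAut.conj g • H : Subgroup G) : Set G))ᶜ ∪ {1}

/-- The geometric series `1 / (1 - c t)` in `ℚ⟦t⟧` (the constant coefficient of the denominator
is `1`, so it is invertible). -/
noncomputable def geomSeries (c : ℕ) : ℚ⟦X⟧ :=
  (1 - PowerSeries.C (c : ℚ) * PowerSeries.X)⁻¹

/-
By Burnside's lemma, `|K| A_K(t) = ∑_{k ∈ K} 1 / (1 - |C_K(k)| t)` for every finite group `K`, so the
claim is a decomposition of this sum for `K = G`. The group `G` is the disjoint union of `{1}`,
`N \ {1}` and the `|G : H| = |N|` distinct conjugates of `H \ {1}`, and the centralizer in `G` of a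
nontrivial element of `N` or of `H` stays inside `N`, respectively `H`.
-/

open Finset

theorem coeff_geomSeries (c n : ℕ) : PowerSeries.coeff n (geomSeries c) = (c : ℚ) ^ n := by
  have h : geomSeries c = PowerSeries.rescale (c : ℚ) (PowerSeries.mk 1) := by
    rw [geomSeries, PowerSeries.inv_eq_iff_mul_eq_one (by simp), ← PowerSeries.rescale_X,
      ← map_one (PowerSeries.rescale (c : ℚ)), ← map_sub, ← map_mul,
      PowerSeries.mk_one_mul_one_sub_eq_one]
  simp [h]

theorem card_fixedBy_pi {M α : Type*} [Monoid M] [MulAction M α] (ι : Type*) [Finite ι] (m : M) :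
    Nat.card (MulAction.fixedBy (ι → α) m) = Nat.card (MulAction.fixedBy α m) ^ Nat.card ι := by
  rw [← Nat.card_fun]
  exact Nat.card_congr <|
    (Equiv.subtypeEquivRight fun _ => funext_iff).trans
      (Equiv.subtypePiEquivPi (p := fun _ a => m • a = a))

theorem fixedBy_conjAct {G : Type*} [Group G] (x : ConjAct G) :
    MulAction.fixedBy G x = Subgroup.centralizer {ConjAct.ofConjAct x} := by
  ext y
  rw [MulAction.mem_fixedBy, ConjAct.smul_def, mul_inv_eq_iff_eq_mul, SetLike.mem_coe,
    Subgroup.mem_centralizer_singleton_iff, eq_comm]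

theorem card_mul_simConjClassNumber (G : Type*) [Group G] [Fintype G] (n : ℕ) :
    Nat.card G * simConjClassNumber G n =
      ∑ g : G, Nat.card (Subgroup.centralizer {g}) ^ n := by
  classical
  have burnside :=
    MulAction.sum_card_fixedBy_eq_card_orbits_mul_card_group (ConjAct G) (Fin n → G)
  simp only [← Nat.card_eq_fintype_card, card_fixedBy_pi, fixedBy_conjAct, Nat.card_fin]
    at burnside
  rw [mul_comm]
  exact burnside.symm

theorem card_mul_simConjSeries (G : Type*) [Group G] [Fintype G] :
    (Nat.card G : ℚ⟦X⟧) * simConjSeries G =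
      ∑ g : G, geomSeries (Nat.card (Subgroup.centralizer {g})) := by
  ext n
  rw [← map_natCast (PowerSeries.C (R := ℚ)), PowerSeries.coeff_C_mul, simConjSeries,
    PowerSeries.coeff_mk, map_sum]
  simp only [coeff_geomSeries]
  exact_mod_cast card_mul_simConjClassNumber G n

theorem card_centralizer_one (G : Type*) [Group G] :
    Nat.card (Subgroup.centralizer {(1 : G)}) = Nat.card G := by
  rw [Subgroup.centralizer_eq_top_iff_subset.2 (by simp), Subgroup.card_top]

theorem card_centralizer_conj {G : Type*} [Group G] (x g : G) :
    Nat.card (Subgroup.centralizer {x * g * x⁻¹}) = Nat.card (Subgroup.centralizer {g}) := by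
  refine (Nat.card_congr ((MulAut.conj x).toEquiv.subtypeEquiv fun y => ?_)).symm
  simp [Subgroup.mem_centralizer_singleton_iff]

/-- A subgroup containing the centralizer of each of its nontrivial elements. (The literature on
CC-subgroups usually also requires `K` to be proper.) -/
def IsCCSubgroup {G : Type*} [Group G] (K : Subgroup G) : Prop :=
  ∀ k ∈ K, k ≠ 1 → Subgroup.centralizer {k} ≤ K

namespace IsCCSubgroup

variable {G : Type*} [Group G] {K : Subgroup G}

theorem card_centralizer_coe (hK : IsCCSubgroup K) {k : K} (hk : k ≠ 1) :
    Nat.card (Subgroup.centralizer {(k : G)}) = Nat.card (Subgroup.centralizer {k}) := by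
  have centralizer_eq : Subgroup.centralizer {k} =
      (Subgroup.centralizer {(k : G)}).subgroupOf K := by
    ext x
    simp [Subgroup.mem_subgroupOf, Subgroup.mem_centralizer_singleton_iff, Subtype.ext_iff]
  rw [centralizer_eq]
  exact Nat.card_congr
    (Subgroup.subgroupOfEquivOfLe (hK k k.2 (by simpa using hk))).symm.toEquiv

open scoped Classical in
theorem sum_geomSeries_card_centralizer [Fintype K] (hK : IsCCSubgroup K) :
    ∑ k : K with k ≠ 1, geomSeries (Nat.card (Subgroup.centralizer {(k : G)})) =
      (Nat.card K : ℚ⟦X⟧) * simConjSeries K - geomSeries (Nat.card K) := by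
  rw [card_mul_simConjSeries, ← card_centralizer_one K, ← sum_erase_eq_sub (mem_univ 1),
    ← filter_ne']
  exact sum_congr rfl fun k hk => by rw [hK.card_centralizer_coe (mem_filter.1 hk).2]

end IsCCSubgroup

theorem notMem_frobeniusKernel_iff {G : Type*} [Group G] {H : Subgroup G} {g : G} :
    g ∉ frobeniusKernel H ↔ ∃ x : G, ∃ h ∈ H, h ≠ 1 ∧ x * h * x⁻¹ = g := by
  simp only [frobeniusKernel, Set.mem_union, Set.mem_compl_iff, Set.mem_iUnion,
    Set.mem_singleton_iff, not_or, not_not, SetLike.mem_coe, Subgroup.mem_smul_pointwise_iff_exists,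
    MulAut.smul_def, MulAut.conj_apply]
  constructor
  · rintro ⟨⟨x, h, hh, rfl⟩, hne⟩
    exact ⟨x, h, hh, by rintro rfl; simp at hne, rfl⟩
  · rintro ⟨x, h, hh, hne, rfl⟩
    exact ⟨⟨x, h, hh, rfl⟩, by simpa using hne⟩

/-- A subgroup that meets each of its conjugates by an element outside it trivially. The Frobenius
complements are the proper nontrivial malnormal subgroups. -/
def IsMalnormal {G : Type*} [Group G] (H : Subgroup G) : Prop :=
  ∀ g : G, g ∉ H → H ⊓ (MulAut.conj g • H) = ⊥

namespace IsMalnormal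

variable {G : Type*} [Group G] {N H : Subgroup G}

theorem mem_of_conj_mem (hH : IsMalnormal H) {x h : G} (hh : h ∈ H) (hne : h ≠ 1)
    (hx : x * h * x⁻¹ ∈ H) : x ∈ H := by
  by_contra hxH
  have hmem : x * h * x⁻¹ ∈ H ⊓ MulAut.conj x • H :=
    ⟨hx, Subgroup.smul_mem_pointwise_smul _ _ _ hh⟩
  rw [hH x hxH, Subgroup.mem_bot, conj_eq_one_iff] at hmem
  exact hne hmem

theorem isCCSubgroup (hH : IsMalnormal H) : IsCCSubgroup H := by
  intro h hh hne x hx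
  rw [Subgroup.mem_centralizer_singleton_iff] at hx
  exact hH.mem_of_conj_mem hh hne (by rwa [hx, mul_inv_cancel_right])

theorem isCCSubgroup_of_coe_eq_frobeniusKernel (hH : IsMalnormal H)
    (hN : (N : Set G) = frobeniusKernel H) : IsCCSubgroup N := by
  intro g hg hne x hx
  by_contra hxN
  rw [← SetLike.mem_coe, hN, notMem_frobeniusKernel_iff] at hxN
  obtain ⟨y, h, hh, h_ne, rfl⟩ := hxN
  have hgH : y⁻¹ * g * y ∈ H := by
    refine hH.isCCSubgroup h hh h_ne ?_
    rw [Subgroup.mem_centralizer_singleton_iff] at hx ⊢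
    simpa [mul_assoc] using congrArg (MulAut.conj y⁻¹) hx.symm
  have hgN : g ∉ frobeniusKernel H :=
    notMem_frobeniusKernel_iff.2
      ⟨y, y⁻¹ * g * y, hgH, by simpa using (conj_eq_one_iff (a := y⁻¹)).not.2 hne, by group⟩
  exact hgN (hN ▸ hg)

theorem mk_eq_mk_of_conj_eq_conj (hH : IsMalnormal H) {x y h k : G} (hh : h ∈ H) (hk : k ∈ H)
    (hne : k ≠ 1) (heq : x * h * x⁻¹ = y * k * y⁻¹) : (x : G ⧸ H) = y := by
  have conj_eq : x⁻¹ * y * k * (x⁻¹ * y)⁻¹ = h := by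
    calc _ = x⁻¹ * (y * k * y⁻¹) * x := by group
      _ = h := by rw [← heq]; group
  exact QuotientGroup.eq.2 (hH.mem_of_conj_mem hk hne (conj_eq.symm ▸ hh))

theorem bijOn_conj_out (hH : IsMalnormal H) :
    Set.BijOn (fun p : (G ⧸ H) × H => p.1.out * p.2 * p.1.out⁻¹) {p | p.2 ≠ 1}
      (frobeniusKernel H)ᶜ := by
  refine ⟨fun p hp => ?_, ?_, fun g hg => ?_⟩
  · exact notMem_frobeniusKernel_iff.2 ⟨p.1.out, p.2, p.2.2, by simpa using hp, rfl⟩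
  · rintro ⟨q, h⟩ - ⟨r, k⟩ hk heq
    obtain rfl : q = r := by
      rw [← q.out_eq', ← r.out_eq']
      exact hH.mk_eq_mk_of_conj_eq_conj h.2 k.2 (by simpa using hk) heq
    simpa using heq
  · obtain ⟨x, h, hh, hne, rfl⟩ := notMem_frobeniusKernel_iff.1 hg
    obtain ⟨k, hk⟩ := QuotientGroup.mk_out_eq_mul H x
    refine ⟨(x, k⁻¹ * ⟨h, hh⟩ * k), ?_, ?_⟩
    · have h_ne : (⟨h, hh⟩ : H) ≠ 1 := by simpa using hne
      simpa using (conj_eq_one_iff (a := k⁻¹)).not.2 h_ne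
    · simp only [hk, Subgroup.coe_mul, Subgroup.coe_inv]
      group

open scoped Classical in
theorem sum_notMem_frobeniusKernel [Fintype G] {M : Type*} [AddCommMonoid M] (hH : IsMalnormal H)
    {f : G → M} (hf : ∀ x g, f (x * g * x⁻¹) = f g) :
    ∑ g with g ∉ frobeniusKernel H, f g = H.index • ∑ h : H with h ≠ 1, f h := by
  have hbij : Set.BijOn (fun p : (G ⧸ H) × H => p.1.out * p.2 * p.1.out⁻¹)
      ↑((univ : Finset (G ⧸ H)) ×ˢ ({h : H | h ≠ 1} : Finset H))
      ↑({g | g ∉ frobeniusKernel H} : Finset G) := by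
    convert hH.bijOn_conj_out using 1 <;> ext <;> simp
  calc ∑ g with g ∉ frobeniusKernel H, f g
      = ∑ p ∈ (univ : Finset (G ⧸ H)) ×ˢ ({h : H | h ≠ 1} : Finset H), f p.2 :=
        (sum_nbij _ hbij.mapsTo hbij.injOn hbij.surjOn fun _ _ => (hf _ _).symm).symm
    _ = H.index • ∑ h : H with h ≠ 1, f h := by
      rw [sum_product]
      simp only [sum_const, card_univ, ← Nat.card_eq_fintype_card, Subgroup.index]

theorem card_frobeniusKernel [Finite G] (hH : IsMalnormal H) :
    Nat.card (frobeniusKernel H) = H.index := by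
  classical
  have := Fintype.ofFinite G
  have card_compl : #{g | g ∉ frobeniusKernel H} = H.index * (Nat.card H - 1) := by
    simpa [filter_ne'] using hH.sum_notMem_frobeniusKernel (f := fun _ => (1 : ℕ)) fun _ _ => rfl
  have card_add_card_compl :
      Nat.card (frobeniusKernel H) + #{g | g ∉ frobeniusKernel H} = Nat.card G := by
    simpa [Fintype.card_subtype] using
      card_filter_add_card_filter_not (s := univ) (· ∈ frobeniusKernel H)
  rw [card_compl, ← H.index_mul_card, Nat.mul_sub_one] at card_add_card_compl
  have index_le : H.index ≤ H.index * Nat.card H := Nat.le_mul_of_pos_right _ Nat.card_pos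
  omega

open scoped Classical in
theorem sum_eq_one_add_kernel_add_complement [Fintype G] {M : Type*} [AddCommMonoid M]
    (hH : IsMalnormal H) (hN : (N : Set G) = frobeniusKernel H) {f : G → M}
    (hf : ∀ x g, f (x * g * x⁻¹) = f g) :
    ∑ g, f g = f 1 + ∑ k : N with k ≠ 1, f k + Nat.card N • ∑ h : H with h ≠ 1, f h := by
  have sum_kernel : ∑ g with g ∈ frobeniusKernel H, f g = f 1 + ∑ k : N with k ≠ 1, f k := by
    rw [filter_ne', ← OneMemClass.coe_one N, add_sum_erase _ (fun k : N => f k) (mem_univ 1)]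
    exact sum_subtype _ (fun g => by simp [← hN]) f
  rw [← sum_filter_add_sum_filter_not univ (· ∈ frobeniusKernel H), sum_kernel,
    hH.sum_notMem_frobeniusKernel hf, ← hH.card_frobeniusKernel, ← hN,
    SetLike.coe_sort_coe]

end IsMalnormal

theorem theorem9p2 {G : Type*} [Group G] [Finite G] (N H : Subgroup G)
    (hH : IsFrobeniusComplement H) (hN : (N : Set G) = frobeniusKernel H) :
    (Nat.card G : ℚ⟦X⟧) * simConjSeries G =
      geomSeries (Nat.card G)
        + ((Nat.card N : ℚ⟦X⟧) * simConjSeries N - geomSeries (Nat.card N))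
        + (Nat.card N : ℚ⟦X⟧) *
            ((Nat.card H : ℚ⟦X⟧) * simConjSeries H - geomSeries (Nat.card H)) := by
  classical
  have := Fintype.ofFinite G
  have malnormal : IsMalnormal H := hH.inf_conj
  have hNcc : IsCCSubgroup N := malnormal.isCCSubgroup_of_coe_eq_frobeniusKernel hN
  rw [card_mul_simConjSeries,
    malnormal.sum_eq_one_add_kernel_add_complement hN fun x g => by rw [card_centralizer_conj],
    hNcc.sum_geomSeries_card_centralizer, malnormal.isCCSubgroup.sum_geomSeries_card_centralizer,
    card_centralizer_one, nsmul_eq_mul]
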